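/- Let $A$ be a finite alphabet. A pattern $P$ is a map from a finite set $D_P\subset\mathbb{Z}$ (its domain) to $A$. It appears in a configuration $c\in A^{\mathbb{Z}}$ if for some $v\in\mathbb{Z}$ one has $c(v+x)=P(x)$ for all $x\in D_P$; it appears in a pattern $M$ if for some $v\in\mathbb{Z}$ and all $x\in D_P$ one has $v+x\in D_M$ and $M(v+x)=P(x)$. A one-dimensional effective subshift over $A$ is a set $X\subseteq A^{\mathbb{Z}}$ of the form $X=\{c : \text{no } P\in F \text{ appears in } c\}$, where $F$ is a recursively enumerable set of patterns. A configuration $c$ is quasi-periodic if for every pattern $P$ that appears in $c$ there is $m\in\mathbb{N}$ such that $P$ appears in every pattern with domain $[-m,m]$ that appears in $c$. The quasi-periodicity function $\mathrm{QP}_c:\mathbb{N}\to\mathbb{N}$ of a quasi-periodic configuration $c$ maps $n$ to the smallest $m$ such that every pattern with domain $[-n,n]$ that appears in $c$ appears in every pattern with domain $[-m,m]$ that appears in $c$. Statement. There exist a finite alphabet $A$ and a non-empty one-dimensional effective subshift $X\subseteq A^{\mathbb{Z}}$ such that, for every quasi-periodic configuration $c\in X$, there is no (total) computable function $q:\mathbb{N}\to\mathbb{N}$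 with $\mathrm{QP}_c(n)\le q(n)$ for all $n\in\mathbb{N}$. -/

import Mathlib

open SymbolicDynamics.FullShift

namespace QPSubshift

/-- The pattern `P` appears in the bi-infinite configuration `c`: some shift of `c` coincides
with `P` on the domain of `P`. -/
def AppearsIn {A : Type*} [Inhabited A] (P : Pattern A ℤ) (c : ℤ → A) : Prop :=
  ∃ v : ℤ, P.occursInAt c v

/-- The pattern `P` appears in the pattern `M`: some shift of `M` is defined on the whole domain
of `P` and coincides with `P` there. -/
def AppearsInPattern {A : Type*} [Inhabited A] (P M : Pattern A ℤ) : Prop :=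
  ∃ v : ℤ, ∀ x ∈ P.support, v + x ∈ M.support ∧ M.config (v + x) = P.config x

/-- The pattern described by a finite list of pairs (position, letter). Its domain is the set of
the positions that are listed, and the letter at a position is the first one listed for it.
Every pattern is described by some list. -/
def patternOfList {A : Type*} [Inhabited A] (l : List (ℤ × A)) : Pattern A ℤ where
  config x := (l.lookup x).getD default
  support := (l.map Prod.fst).toFinset
  condition x hx := by
    have h : l.lookup x = none := by
      rw [List.lookup_eq_none_iff]
      intro p hp
      have hne : x ≠ p.1 := by
        rintro rfl
        exact hx (List.mem_toFinset.2 (List.mem_map_of_mem hp))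
      simpa using hne
    rw [h, Option.getD_none]

/-- A set of patterns is recursively enumerable: its members are the patterns described by the
lists of a recursively enumerable set of lists. -/
def IsREPatternSet {A : Type*} [Inhabited A] [Primcodable A] (F : Set (Pattern A ℤ)) : Prop :=
  ∃ L : List (ℤ × A) → Prop, REPred L ∧ F = patternOfList '' {l | L l}

/-- An effective subshift: the configurations avoiding a recursively enumerable set of
forbidden patterns. -/
def IsEffective {A : Type*} [Inhabited A] [Primcodable A] [TopologicalSpace A]
    [DiscreteTopology A] (X : Subshift A ℤ) : Prop :=
  ∃ F : Set (Pattern A ℤ), IsREPatternSet F ∧ X = Subshift.ofForbidden F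

/-- Every pattern that appears in `c` appears in every pattern of `c` with domain `[-m, m]`,
for some `m` that depends on the pattern. -/
def IsQuasiPeriodic {A : Type*} [Inhabited A] (c : ℤ → A) : Prop :=
  ∀ P : Pattern A ℤ, AppearsIn P c → ∃ m : ℕ, ∀ M : Pattern A ℤ,
    M.support = Finset.Icc (-(m : ℤ)) m → AppearsIn M c → AppearsInPattern P M

/-- Every pattern of `c` with domain `[-n, n]` appears in every pattern of `c` with domain
`[-m, m]`. -/
def IsQPBound {A : Type*} [Inhabited A] (c : ℤ → A) (n m : ℕ) : Prop :=
  ∀ P : Pattern A ℤ, P.support = Finset.Icc (-(n : ℤ)) n → AppearsIn P c →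
    ∀ M : Pattern A ℤ, M.support = Finset.Icc (-(m : ℤ)) m → AppearsIn M c →
      AppearsInPattern P M

/-- The quasi-periodicity function of `c`: it maps `n` to the smallest `m` such that every pattern
of `c` with domain `[-n, n]` appears in every pattern of `c` with domain `[-m, m]`. Such an `m`
exists when `c` is quasi-periodic, see `exists_isQPBound`. -/
noncomputable def qpFunction {A : Type*} [Inhabited A] (c : ℤ → A) (n : ℕ) : ℕ :=
  sInf {m : ℕ | IsQPBound c n m}

theorem exists_isQPBound {A : Type*} [Inhabited A] [Finite A] {c : ℤ → A}
    (hc : IsQuasiPeriodic c) (n : ℕ) : ∃ m : ℕ, IsQPBound c n m := by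
  classical
  have hfin := finite_setOfPred_pattern_support_eq (A := A) (Finset.Icc (-(n : ℤ)) n)
  choose! f hf using hc
  obtain ⟨m, hm⟩ := (hfin.image f).bddAbove
  refine ⟨m, fun P hP hPc M hM hMc => ?_⟩
  have hle : f P ≤ m := hm ⟨P, hP, rfl⟩
  -- cut `M` down to the smaller window `[-f P, f P]`
  obtain ⟨v, hv⟩ := hMc
  have hsub : ∀ x ∈ Finset.Icc (-(f P : ℤ)) (f P), x ∈ M.support := by
    intro x hx
    rw [hM]
    simp only [Finset.mem_Icc] at hx ⊢
    omega
  obtain ⟨w, hw⟩ := hf P hPc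
    { config := fun x => if x ∈ Finset.Icc (-(f P : ℤ)) (f P) then M.config x else default
      support := Finset.Icc (-(f P : ℤ)) (f P)
      condition := fun x hx => if_neg hx } rfl
    ⟨v, fun x hx => (hv x (hsub x hx)).trans (if_pos hx).symm⟩
  refine ⟨w, fun x hx => ?_⟩
  obtain ⟨h1, h2⟩ := hw x hx
  exact ⟨hsub _ h1, by rw [← h2]; exact (if_pos h1).symm⟩

end QPSubshift

open Nat.Partrec (Code)
open Nat.Partrec.Code
namespace QPSubshift

/-! Spread the halting problem over a 2-adic hierarchy. A position `u` with lowest binary digits one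
at `e < t` carries the parity of `e` and the bit "program `e` halts within `t` steps". Only finite
levels are tested, so the words that fit at no residue modulo `2 ^ s` form an r.e. set
(`rePred_exists_isRefuted`), and a configuration avoiding them has an offset at every stage
(`exists_offset`).

The parities in a window of length about `2 ^ (e + 2)` fix the position modulo `2 ^ (e + 1)`
(`parity_rigidity`), hence reveal level `e`. If `e` halts, its bit is 1 at some position with large
`t`. By quasi-periodicity the window there recurs near any prescribed place, in particular where `t`
must be small compared with the recurrence bound `m`; the bit 1 read there says that `e` halts
within `m + e + 2` steps. A computable bound on `qpFunction` would therefore decide halting. -/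

/-- The program with number `e`, run on the input `0`, halts within `t` steps. -/
def HaltsWithin (e t : ℕ) : Prop :=
  (evaln t (Denumerable.ofNat Code e) 0).isSome = true

theorem HaltsWithin.mono {e t t' : ℕ} (h : HaltsWithin e t) (htt : t ≤ t') :
    HaltsWithin e t' := by
  obtain ⟨x, hx⟩ := Option.isSome_iff_exists.1 h
  exact Option.isSome_iff_exists.2 ⟨x, evaln_mono htt hx⟩

theorem dom_eval_iff_exists_haltsWithin (p : Code) :
    (eval p 0).Dom ↔ ∃ t, HaltsWithin (Encodable.encode p) t := by
  simp only [HaltsWithin, Denumerable.ofNat_encode, Option.isSome_iff_exists, Part.dom_iff_mem]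
  constructor
  · rintro ⟨y, hy⟩
    obtain ⟨k, hk⟩ := evaln_complete.1 hy
    exact ⟨k, y, hk⟩
  · rintro ⟨k, y, hk⟩
    exact ⟨y, evaln_complete.2 ⟨k, hk⟩⟩

theorem primrecRel_haltsWithin : PrimrecRel HaltsWithin := by
  classical
  have h : Primrec fun p : ℕ × ℕ => (evaln p.2 (Denumerable.ofNat Code p.1) 0).isSome :=
    Primrec.option_isSome.comp (primrec_evaln.comp
      ((Primrec.snd.pair ((Primrec.ofNat Code).comp Primrec.fst)).pair (Primrec.const 0)))
  exact (Primrec.eq.comp h (Primrec.const true))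

/-! ### Admissible letters and their decidability -/

/-- The letter `a` is admissible at the position `u` of the hierarchical structure, as far as the
first `s` levels can tell. The parity of `a` is the parity of the 2-adic valuation `e` of `u`, and
`a / 2` tells whether the program `e` halts within `t` steps, where `t` is the 2-adic valuation
of `u - 2 ^ e`. -/
def Admissible (s : ℕ) (u : ℤ) (a : Fin 4) : Prop :=
  ∀ e < s, u % 2 ^ (e + 1) = 2 ^ e → (a : ℕ) % 2 = e % 2 ∧
    ∀ t < s, e < t → u % 2 ^ (t + 1) = 2 ^ e + 2 ^ t → ((a : ℕ) / 2 = 1 ↔ HaltsWithin e t)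

theorem admissible_natCast (s u : ℕ) (a : Fin 4) :
    Admissible s u a ↔ ∀ e < s, u % 2 ^ (e + 1) = 2 ^ e → (a : ℕ) % 2 = e % 2 ∧
      ∀ t < s, e < t → u % 2 ^ (t + 1) = 2 ^ e + 2 ^ t → ((a : ℕ) / 2 = 1 ↔ HaltsWithin e t) := by
  unfold Admissible
  norm_cast

/-- Levels below `s` only read the last `s` binary digits of the position. -/
theorem Admissible.of_emod_eq {s : ℕ} {u u' : ℤ} {a : Fin 4} (h : Admissible s u a)
    (hu : u % 2 ^ s = u' % 2 ^ s) : Admissible s u' a := by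
  have key : ∀ t < s, u % 2 ^ (t + 1) = u' % 2 ^ (t + 1) := fun t ht =>
    Int.ModEq.of_dvd (pow_dvd_pow 2 ht) hu
  intro e he hue
  obtain ⟨h1, h2⟩ := h e he ((key e he).trans hue)
  exact ⟨h1, fun t ht het hut => h2 t ht het ((key t ht).trans hut)⟩

theorem primrec_two_pow : Primrec fun n : ℕ => 2 ^ n := by
  have h : Primrec₂ fun m n : ℕ => m ^ n := Primrec₂.unpaired'.1 Nat.Primrec.pow
  exact h.comp (Primrec.const 2) Primrec.id

theorem _root_.PrimrecPred.imp {α : Type*} [Primcodable α] {p q : α → Prop}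
    (hp : PrimrecPred p) (hq : PrimrecPred q) : PrimrecPred fun a => p a → q a := by
  classical
  exact (hp.not.or hq).of_eq fun _ => imp_iff_not_or.symm

theorem _root_.PrimrecPred.iff {α : Type*} [Primcodable α] {p q : α → Prop}
    (hp : PrimrecPred p) (hq : PrimrecPred q) : PrimrecPred fun a => p a ↔ q a :=
  ((hp.imp hq).and (hq.imp hp)).of_eq fun _ => iff_iff_implies_and_implies.symm

theorem _root_.PrimrecPred.forall_lt_of {α : Type*} [Primcodable α] {p : α → ℕ → Prop} {f : α → ℕ}
    (hf : Primrec f) (hp : PrimrecPred fun q : ℕ × α => p q.2 q.1) :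
    PrimrecPred fun a => ∀ n < f a, p a n :=
  ((PrimrecRel.forall_mem_list (R := fun n a => p a n) hp).comp (Primrec.list_range.comp hf)
    Primrec.id).of_eq fun _ => by simp

theorem _root_.PrimrecPred.exists_lt_of {α : Type*} [Primcodable α] {p : α → ℕ → Prop} {f : α → ℕ}
    (hf : Primrec f) (hp : PrimrecPred fun q : ℕ × α => p q.2 q.1) :
    PrimrecPred fun a => ∃ n < f a, p a n :=
  ((PrimrecRel.exists_mem_list (R := fun n a => p a n) hp).comp (Primrec.list_range.comp hf)
    Primrec.id).of_eq fun _ => by simp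

theorem primrecPred_emod_two_pow_eq {α : Type*} [Primcodable α] {u e v : α → ℕ}
    (hu : Primrec u) (he : Primrec e) (hv : Primrec v) :
    PrimrecPred fun x => u x % 2 ^ (e x + 1) = v x :=
  Primrec.eq.comp (Primrec.nat_mod.comp hu (primrec_two_pow.comp (Primrec.succ.comp he))) hv

theorem primrecPred_admissible :
    PrimrecPred fun p : ℕ × ℕ × Fin 4 => Admissible p.1 (p.2.1 : ℕ) p.2.2 := by
  have hinner : PrimrecPred fun p : ℕ × ℕ × ℕ × ℕ × Fin 4 =>
      p.2.1 < p.1 → p.2.2.2.1 % 2 ^ (p.1 + 1) = 2 ^ p.2.1 + 2 ^ p.1 →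
        ((p.2.2.2.2 : ℕ) / 2 = 1 ↔ HaltsWithin p.2.1 p.1) := by
    have ht : Primrec fun p : ℕ × ℕ × ℕ × ℕ × Fin 4 => p.1 := Primrec.fst
    have he : Primrec fun p : ℕ × ℕ × ℕ × ℕ × Fin 4 => p.2.1 := Primrec.fst.comp Primrec.snd
    have hu : Primrec fun p : ℕ × ℕ × ℕ × ℕ × Fin 4 => p.2.2.2.1 :=
      Primrec.fst.comp (Primrec.snd.comp (Primrec.snd.comp Primrec.snd))
    have ha : Primrec fun p : ℕ × ℕ × ℕ × ℕ × Fin 4 => (p.2.2.2.2 : ℕ) :=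
      Primrec.fin_val.comp (Primrec.snd.comp (Primrec.snd.comp (Primrec.snd.comp Primrec.snd)))
    have h1 := Primrec.nat_lt.comp he ht
    have h2 := primrecPred_emod_two_pow_eq hu ht
      (Primrec.nat_add.comp (primrec_two_pow.comp he) (primrec_two_pow.comp ht))
    have h3 := Primrec.eq.comp (Primrec.nat_div.comp ha (Primrec.const 2)) (Primrec.const 1)
    have h4 := primrecRel_haltsWithin.comp he ht
    exact h1.imp (h2.imp (h3.iff h4))
  have houter : PrimrecPred fun p : ℕ × ℕ × ℕ × Fin 4 =>
      p.2.2.1 % 2 ^ (p.1 + 1) = 2 ^ p.1 → (p.2.2.2 : ℕ) % 2 = p.1 % 2 ∧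
      ∀ t < p.2.1, p.1 < t → p.2.2.1 % 2 ^ (t + 1) = 2 ^ p.1 + 2 ^ t →
        ((p.2.2.2 : ℕ) / 2 = 1 ↔ HaltsWithin p.1 t) := by
    have he : Primrec fun p : ℕ × ℕ × ℕ × Fin 4 => p.1 := Primrec.fst
    have hs : Primrec fun p : ℕ × ℕ × ℕ × Fin 4 => p.2.1 := Primrec.fst.comp Primrec.snd
    have hu : Primrec fun p : ℕ × ℕ × ℕ × Fin 4 => p.2.2.1 :=
      Primrec.fst.comp (Primrec.snd.comp Primrec.snd)
    have ha : Primrec fun p : ℕ × ℕ × ℕ × Fin 4 => (p.2.2.2 : ℕ) :=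
      Primrec.fin_val.comp (Primrec.snd.comp (Primrec.snd.comp Primrec.snd))
    have h1 := primrecPred_emod_two_pow_eq hu he (primrec_two_pow.comp he)
    have h2 := Primrec.eq.comp (Primrec.nat_mod.comp ha (Primrec.const 2))
      (Primrec.nat_mod.comp he (Primrec.const 2))
    exact h1.imp (h2.and (PrimrecPred.forall_lt_of hs hinner))
  exact (PrimrecPred.forall_lt_of Primrec.fst houter).of_eq
    fun p => (admissible_natCast p.1 p.2.1 p.2.2).symm

/-! ### Refuted words and the enumerable forbidden set -/

/-- The word `w` fits nowhere in the hierarchical structure, as far as the first `s` levels can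
tell. -/
def IsRefuted (s : ℕ) (w : List (Fin 4)) : Prop :=
  ∀ r < 2 ^ s, ∃ i < w.length, ¬ Admissible s ((r + i : ℕ) : ℤ) (w.getD i 0)

theorem primrecPred_isRefuted :
    PrimrecPred fun p : ℕ × List (Fin 4) => IsRefuted p.1 p.2 := by
  have h1 : PrimrecPred fun q : ℕ × ℕ × ℕ × List (Fin 4) =>
      ¬ Admissible q.2.2.1 ((q.2.1 + q.1 : ℕ) : ℤ) (q.2.2.2.getD q.1 0) := by
    have h3 : Primrec fun q : ℕ × ℕ × ℕ × List (Fin 4) =>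
        (q.2.2.1, q.2.1 + q.1, q.2.2.2.getD q.1 0) := by
      refine Primrec.pair ?_ (Primrec.pair ?_ ?_)
      · exact Primrec.fst.comp (Primrec.snd.comp Primrec.snd)
      · exact Primrec.nat_add.comp (Primrec.fst.comp Primrec.snd) Primrec.fst
      · exact (Primrec.list_getD 0).comp (Primrec.snd.comp (Primrec.snd.comp Primrec.snd))
          Primrec.fst
    exact (primrecPred_admissible.comp h3).not
  have h2 : PrimrecPred fun q : ℕ × ℕ × List (Fin 4) =>
      ∃ i < q.2.2.length, ¬ Admissible q.2.1 ((q.1 + i : ℕ) : ℤ) (q.2.2.getD i 0) :=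
    PrimrecPred.exists_lt_of (Primrec.list_length.comp (Primrec.snd.comp Primrec.snd)) h1
  exact PrimrecPred.forall_lt_of (primrec_two_pow.comp Primrec.fst) h2

/-- The word `w`, as a list of pairs (position, letter), the positions starting at `0`. -/
def listOfWord (w : List (Fin 4)) : List (ℤ × Fin 4) :=
  (List.range w.length).map fun i : ℕ => ((i : ℤ), w.getD i 0)

theorem primrec_intCast : Primrec fun n : ℕ => (n : ℤ) := by
  refine Primrec.encode_iff.1 ((Primrec.nat_double).of_eq fun n => ?_)
  -- The encoding of `ℤ` sends a natural number `n` to `2 * n`, so on codes the cast is doubling.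
  rfl

theorem primrec_listOfWord : Primrec listOfWord := by
  refine Primrec.list_map (Primrec.list_range.comp Primrec.list_length) ?_
  exact Primrec.pair (primrec_intCast.comp Primrec.snd)
    ((Primrec.list_getD 0).comp Primrec.fst Primrec.snd)

theorem mem_support_patternOfList_listOfWord {w : List (Fin 4)} {x : ℤ} :
    x ∈ (patternOfList (listOfWord w)).support ↔ ∃ i : ℕ, i < w.length ∧ (i : ℤ) = x := by
  simp [patternOfList, listOfWord]

theorem config_patternOfList_listOfWord {w : List (Fin 4)} {i : ℕ} (hi : i < w.length) :
    (patternOfList (listOfWord w)).config i = w.getD i 0 := by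
  have key : ∀ l : List ℕ, i ∈ l →
      (l.map fun j : ℕ => ((j : ℤ), w.getD j 0)).lookup (i : ℤ) = some (w.getD i 0) := by
    intro l
    induction l with
    | nil => simp
    | cons j l ih =>
      intro h
      by_cases hij : i = j
      · subst hij; simp
      · have hne : ((i : ℤ) == (j : ℤ)) = false := by simpa using hij
        rw [List.map_cons, List.lookup_cons, hne]
        exact ih ((List.mem_cons.1 h).resolve_left hij)
  simp only [patternOfList, listOfWord]
  rw [key _ (List.mem_range.2 hi), Option.getD_some]

/-- Refutation by a given stage is decidable, so an unbounded search over the codes of pairs `(s,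
w)` semi-decides the set. -/
theorem rePred_exists_isRefuted :
    REPred fun l : List (ℤ × Fin 4) => ∃ s w, IsRefuted s w ∧ listOfWord w = l := by
  classical
  let f : List (ℤ × Fin 4) → ℕ → Option Unit := fun l n =>
    (Encodable.decode (α := ℕ × List (Fin 4)) n).bind fun p =>
      if IsRefuted p.1 p.2 ∧ listOfWord p.2 = l then some () else none
  have hf : Primrec₂ f := by
    refine Primrec.option_bind (Primrec.decode.comp Primrec.snd) (Primrec.ite
      (PrimrecPred.and (primrecPred_isRefuted.comp Primrec.snd) (Primrec.eq.comp
        (primrec_listOfWord.comp (Primrec.snd.comp Primrec.snd))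
        (Primrec.fst.comp Primrec.fst))) (Primrec.const _) (Primrec.const _))
  refine (Partrec.dom_re (Partrec.rfindOpt hf.to_comp)).of_eq fun l => ?_
  rw [Nat.rfindOpt_dom]
  constructor
  · rintro ⟨n, a, h⟩
    obtain ⟨p, _, hp⟩ := Option.mem_bind_iff.1 h
    by_contra hne
    rw [if_neg (fun h => hne ⟨_, _, h⟩)] at hp
    simp at hp
  · rintro ⟨s, w, h⟩
    refine ⟨Encodable.encode (s, w), (), ?_⟩
    simp [f, h]

/-- The patterns given by the words that are refuted by finitely many levels. -/
def refutedPatterns : Set (SymbolicDynamics.FullShift.Pattern (Fin 4) ℤ) :=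
  patternOfList '' {l | ∃ s w, IsRefuted s w ∧ listOfWord w = l}

/-! ### Binary digits of positions -/

theorem emod_two_pow_succ (u : ℤ) (k : ℕ) :
    u % 2 ^ (k + 1) = u % 2 ^ k ∨ u % 2 ^ (k + 1) = u % 2 ^ k + 2 ^ k := by
  have h0 : (0 : ℤ) < 2 ^ k := by positivity
  have h1 : u % 2 ^ (k + 1) % 2 ^ k = u % 2 ^ k :=
    Int.emod_emod_of_dvd _ (pow_dvd_pow 2 k.le_succ)
  have h2 := Int.emod_nonneg u (b := 2 ^ (k + 1)) (by positivity)
  have h3 := Int.emod_lt_of_pos u (b := 2 ^ (k + 1)) (by positivity)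
  have h5 : (2 : ℤ) ^ (k + 1) = 2 ^ k * 2 := pow_succ 2 k
  rcases lt_or_ge (u % 2 ^ (k + 1)) (2 ^ k) with h | h
  · left; rw [← h1, Int.emod_eq_of_lt h2 h]
  · right
    have h4 : (u % 2 ^ (k + 1) - 2 ^ k) % 2 ^ k = u % 2 ^ k := by
      rw [Int.sub_emod_right, h1]
    rw [Int.emod_eq_of_lt (by linarith) (by linarith)] at h4
    linarith

/-- The witness `t` is the second lowest nonzero digit of `u`; `hT` says that it occurs below `T`.
-/
theorem exists_emod_two_pow_eq_add {u : ℤ} {e T : ℕ} (h : u % 2 ^ (e + 1) = 2 ^ e) (heT : e < T)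
    (hT : u % 2 ^ T ≠ 2 ^ e) : ∃ t < T, e < t ∧ u % 2 ^ (t + 1) = 2 ^ e + 2 ^ t := by
  induction T, heT using Nat.le_induction with
  | base => exact absurd h hT
  | succ T heT ih =>
    by_cases hu : u % 2 ^ T = 2 ^ e
    · refine ⟨T, T.lt_succ_self, heT, ?_⟩
      rcases emod_two_pow_succ u T with h' | h'
      · exact absurd (h'.trans hu) hT
      · rw [h', hu]
    · obtain ⟨t, ht, h'⟩ := ih hu
      exact ⟨t, ht.trans T.lt_succ_self, h'⟩

theorem emod_two_pow_of_le {u v : ℤ} {k l : ℕ} (h : u % 2 ^ l = v) (hkl : k ≤ l) :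
    u % 2 ^ k = v % 2 ^ k := by
  rw [← h, Int.emod_emod_of_dvd _ (pow_dvd_pow 2 hkl)]

theorem two_pow_emod_two_pow_of_lt {e k : ℕ} (h : e < k) : (2 : ℤ) ^ e % 2 ^ k = 2 ^ e :=
  Int.emod_eq_of_lt (by positivity) (pow_lt_pow_right₀ (by norm_num) h)

theorem two_pow_emod_two_pow_of_le {e k : ℕ} (h : k ≤ e) : (2 : ℤ) ^ e % 2 ^ k = 0 :=
  Int.emod_eq_zero_of_dvd (pow_dvd_pow 2 h)

theorem two_pow_add_two_pow_emod {e t k : ℕ} (he : e < k) (ht : k ≤ t) :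
    ((2 : ℤ) ^ e + 2 ^ t) % 2 ^ k = 2 ^ e := by
  rw [Int.add_emod, two_pow_emod_two_pow_of_le ht, add_zero, Int.emod_emod,
    two_pow_emod_two_pow_of_lt he]

theorem two_pow_add_two_pow_emod_self {e t : ℕ} (h : e < t) :
    ((2 : ℤ) ^ e + 2 ^ t) % 2 ^ (t + 1) = 2 ^ e + 2 ^ t := by
  refine Int.emod_eq_of_lt (by positivity) ?_
  have := pow_lt_pow_right₀ (a := (2 : ℤ)) (by norm_num) h
  rw [pow_succ]; linarith

theorem level_unique {u : ℤ} {e e' : ℕ} (h : u % 2 ^ (e + 1) = 2 ^ e)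
    (h' : u % 2 ^ (e' + 1) = 2 ^ e') : e = e' := by
  by_contra hne
  wlog hlt : e < e' generalizing e e'
  · exact this h' h (Ne.symm hne) (by omega)
  have := emod_two_pow_of_le h' (k := e + 1) (by omega)
  rw [h, two_pow_emod_two_pow_of_le hlt] at this
  exact pow_ne_zero e (by norm_num) this

theorem second_level_unique {u : ℤ} {e t t' : ℕ} (het : e < t) (het' : e < t')
    (h : u % 2 ^ (t + 1) = 2 ^ e + 2 ^ t) (h' : u % 2 ^ (t' + 1) = 2 ^ e + 2 ^ t') : t = t' := by
  by_contra hne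
  wlog hlt : t < t' generalizing t t'
  · exact this het' het h' h (Ne.symm hne) (by omega)
  have := emod_two_pow_of_le h' (k := t + 1) (by omega)
  rw [h, two_pow_add_two_pow_emod (by omega) hlt] at this
  have h2 : (2 : ℤ) ^ t = 0 := by linarith
  exact pow_ne_zero t (by norm_num) h2

/-! ### The subshift: non-emptiness and offsets -/

theorem exists_forall_admissible (u : ℤ) : ∃ a : Fin 4, ∀ s, Admissible s u a := by
  classical
  -- Where a level does not exist (`u = 0` for the first, `u = 2 ^ e` for the second) the value is
  -- unconstrained and defaults to 0.
  let x : ℕ := if ∃ e : ℕ, e % 2 = 1 ∧ u % 2 ^ (e + 1) = 2 ^ e then 1 else 0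
  let y : ℕ := if ∃ e t : ℕ, e < t ∧ HaltsWithin e t ∧ u % 2 ^ (e + 1) = 2 ^ e ∧
    u % 2 ^ (t + 1) = 2 ^ e + 2 ^ t then 1 else 0
  have hx : x < 2 := by dsimp only [x]; split_ifs <;> norm_num
  have hy : y < 2 := by dsimp only [y]; split_ifs <;> norm_num
  refine ⟨⟨x + 2 * y, by omega⟩, fun s e _ hu => ⟨?_, fun t _ het hut => ?_⟩⟩
  · have : x = e % 2 := by
      dsimp only [x]
      split_ifs with h
      · obtain ⟨e', he', hu'⟩ := h
        rw [level_unique hu hu', he']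
      · exact ((Nat.mod_two_eq_zero_or_one e).resolve_right fun h1 => h ⟨e, h1, hu⟩).symm
    simp only
    omega
  · have h1 : (x + 2 * y) / 2 = y := by omega
    simp only [h1]
    constructor
    · intro h
      have h2 : ∃ e t : ℕ, e < t ∧ HaltsWithin e t ∧ u % 2 ^ (e + 1) = 2 ^ e ∧
          u % 2 ^ (t + 1) = 2 ^ e + 2 ^ t := by
        by_contra hne
        rw [show y = 0 from if_neg hne] at h
        omega
      obtain ⟨e', t', het', hh, hu', hut'⟩ := h2
      obtain rfl := level_unique hu hu'
      rwa [second_level_unique het het' hut hut']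
    · intro h
      exact if_pos ⟨e, t, het, h, hu, hut⟩

theorem mem_forbidden_refutedPatterns_iff {c : ℤ → Fin 4} :
    c ∈ SymbolicDynamics.FullShift.forbidden refutedPatterns ↔
      ∀ s N : ℕ, ∀ v : ℤ, ∃ r < 2 ^ s, ∀ i < N, Admissible s ((r + i : ℕ) : ℤ) (c (v + i)) := by
  constructor
  · intro hc s N v
    by_contra! hne
    let w : List (Fin 4) := List.ofFn fun i : Fin N => c (v + (i : ℕ))
    have hw : ∀ i < N, w.getD i 0 = c (v + i) := fun i hi => by simp [w, hi]
    have hlen : w.length = N := List.length_ofFn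
    refine hc _ ⟨_, ⟨s, w, fun r hr => ?_, rfl⟩, rfl⟩ v fun x hx => ?_
    · obtain ⟨i, hi, h⟩ := hne r hr
      exact ⟨i, hlen.symm ▸ hi, by rwa [hw i hi]⟩
    · obtain ⟨i, hi, rfl⟩ := mem_support_patternOfList_listOfWord.1 hx
      rw [config_patternOfList_listOfWord hi, hw i (hlen ▸ hi)]
  · rintro hc _ ⟨_, ⟨s, w, hw, rfl⟩, rfl⟩ v hv
    obtain ⟨r, hr, h⟩ := hc s w.length v
    obtain ⟨i, hi, hi'⟩ := hw r hr
    apply hi'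
    rw [← config_patternOfList_listOfWord hi,
      ← hv i (mem_support_patternOfList_listOfWord.2 ⟨i, hi, rfl⟩)]
    exact h i hi

theorem nonempty_forbidden_refutedPatterns :
    (SymbolicDynamics.FullShift.forbidden refutedPatterns).Nonempty := by
  choose c hc using exists_forall_admissible
  refine ⟨c, mem_forbidden_refutedPatterns_iff.2 fun s N v => ⟨(v % 2 ^ s).toNat, ?_, ?_⟩⟩
  · have := Int.emod_lt_of_pos v (b := 2 ^ s) (by positivity)
    zify
    rwa [Int.toNat_of_nonneg (Int.emod_nonneg _ (by positivity))]
  · intro i _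
    refine (hc (v + i) s).of_emod_eq ?_
    push_cast
    rw [Int.toNat_of_nonneg (Int.emod_nonneg _ (by positivity)), Int.emod_add_emod]

/-- A configuration that contains no refuted word has, at each stage, a global offset. -/
theorem exists_offset {c : ℤ → Fin 4}
    (hc : c ∈ SymbolicDynamics.FullShift.forbidden refutedPatterns) (s : ℕ) :
    ∃ r : ℤ, ∀ x, Admissible s (x + r) (c x) := by
  by_contra! hne
  choose f hf using hne
  -- Only `2 ^ s` residues matter, so one window `[-N, N)` contains a failure of each of them and
  -- would be refuted.
  obtain ⟨N, hN⟩ : ∃ N : ℕ, ∀ r : ℕ, r < 2 ^ s → (f r).natAbs < N := by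
    obtain ⟨N, hN⟩ := ((Finset.range (2 ^ s)).image fun r : ℕ => (f r).natAbs).bddAbove
    exact ⟨N + 1, fun r hr => Nat.lt_succ_of_le (hN (by
      simp only [Finset.coe_image, Finset.coe_range]; exact ⟨r, hr, rfl⟩))⟩
  obtain ⟨r, -, hr⟩ := mem_forbidden_refutedPatterns_iff.1 hc s (2 * N) (-N)
  have hlt : (r + N) % 2 ^ s < 2 ^ s := Nat.mod_lt _ (by positivity)
  set r' : ℕ := (r + N) % 2 ^ s with hr'
  have hx := hN r' hlt
  refine hf r' ?_
  set x := f r'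
  have hi := hr (x + N).toNat (by omega)
  have hxN : ((x + N).toNat : ℤ) = x + N := Int.toNat_of_nonneg (by omega)
  rw [hxN, neg_add_cancel_comm_assoc] at hi
  refine hi.of_emod_eq ?_
  rw [hr']
  push_cast
  rw [Int.add_emod_emod, hxN]
  congr 1
  ring

/-! ### From quasi-periodicity to halting times -/

/-- If `u' - u` had 2-adic valuation `k ≤ e`, a shift putting `u` at level `k + 1` would put `u'` at
level `k`, and the parities would differ. -/
theorem parity_rigidity {D : ℤ → ℕ} {s e : ℕ} (hes : e + 1 < s)
    (hD : ∀ k < s, ∀ u : ℤ, u % 2 ^ (k + 1) = 2 ^ k → D u = k % 2) {u u' : ℤ}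
    (h : ∀ d : ℤ, 0 ≤ d → d ≤ 2 ^ (e + 2) → D (u + d) = D (u' + d)) :
    (2 : ℤ) ^ (e + 1) ∣ u' - u := by
  suffices ∀ k ≤ e + 1, (2 : ℤ) ^ k ∣ u' - u from this _ le_rfl
  intro k
  induction k with
  | zero => simp
  | succ k ih =>
    intro hk
    have h0 := Int.emod_eq_zero_of_dvd (ih (by omega))
    rcases emod_two_pow_succ (u' - u) k with h1 | h1
    · exact Int.dvd_of_emod_eq_zero (h1.trans h0)
    exfalso
    rw [h0, zero_add] at h1
    set d := (2 ^ (k + 1) - u) % 2 ^ (k + 2) with hd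
    have hd0 : 0 ≤ d := Int.emod_nonneg _ (by positivity)
    have hd1 : d < 2 ^ (k + 2) := Int.emod_lt_of_pos _ (by positivity)
    have hd2 : (2 : ℤ) ^ (k + 2) ≤ 2 ^ (e + 2) := pow_le_pow_right₀ (by norm_num) (by omega)
    have hu : (u + d) % 2 ^ (k + 1 + 1) = 2 ^ (k + 1) := by
      rw [hd, Int.add_emod_emod, add_sub_cancel, two_pow_emod_two_pow_of_lt (by omega)]
    have hu' : (u' + d) % 2 ^ (k + 1) = 2 ^ k := by
      have h2 := emod_two_pow_of_le hu (k := k + 1) (by omega)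
      rw [two_pow_emod_two_pow_of_le le_rfl] at h2
      rw [show u' + d = (u + d) + (u' - u) by ring, Int.add_emod, h2, h1, zero_add,
        two_pow_emod_two_pow_of_lt k.lt_succ_self]
    have := h d hd0 (by linarith)
    rw [hD _ (by omega) _ hu, hD _ (by omega) _ hu'] at this
    omega

theorem window_agree {c : ℤ → Fin 4} {n m : ℕ} (h : IsQPBound c n m) (x y : ℤ) :
    ∃ z : ℤ, y - m ≤ z ∧ z ≤ y + m ∧ ∀ d : ℤ, 0 ≤ d → d ≤ n → c (z + d) = c (x + d) := by
  classical
  let W : ℕ → ℤ → SymbolicDynamics.FullShift.Pattern (Fin 4) ℤ := fun k v =>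
    { config := fun d => if d ∈ Finset.Icc (-(k : ℤ)) k then c (v + d) else default
      support := Finset.Icc (-(k : ℤ)) k
      condition := fun d hd => if_neg hd }
  have hW : ∀ k v, AppearsIn (W k v) c := fun k v => ⟨v, fun d hd => (if_pos hd).symm⟩
  obtain ⟨v, hv⟩ := h (W n x) rfl (hW n x) (W m y) rfl (hW m y)
  have key : ∀ d ∈ Finset.Icc (-(n : ℤ)) n,
      v + d ∈ Finset.Icc (-(m : ℤ)) m ∧ c (y + (v + d)) = c (x + d) := fun d hd => by
    obtain ⟨h1, h2⟩ := hv d hd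
    exact ⟨h1, ((if_pos h1).symm.trans h2).trans (if_pos hd)⟩
  have h0 := Finset.mem_Icc.1 (key 0 (by simp)).1
  refine ⟨y + v, by omega, by omega, fun d hd hd' => ?_⟩
  rw [add_assoc]
  exact (key d (Finset.mem_Icc.2 ⟨by omega, hd'⟩)).2

/-- A bound for the quasi-periodicity function at `2 ^ (e + 2)` bounds the halting time of the
program `e`. -/
theorem haltsWithin_of_isQPBound {c : ℤ → Fin 4}
    (hc : c ∈ SymbolicDynamics.FullShift.forbidden refutedPatterns) {e t m : ℕ}
    (hm : IsQPBound c (2 ^ (e + 2)) m) (ht : HaltsWithin e t) : HaltsWithin e (m + e + 2) := by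
  set T := m + e + 2 with hT
  by_contra hnot
  have htT : T < t := lt_of_not_ge fun h => hnot (ht.mono h)
  obtain ⟨r, hr⟩ := exists_offset hc (t + 1)
  -- The source position has second level `t`. The target has second level `T - 1`, and moving it by
  -- at most `m < 2 ^ (T - 1)` keeps it strictly between `2 ^ e` and `2 ^ e + 2 ^ T`.
  obtain ⟨z, hz1, hz2, hz⟩ := window_agree hm (2 ^ e + 2 ^ t - r) (2 ^ e + 2 ^ (T - 1) - r)
  have hdvd : (2 : ℤ) ^ (e + 1) ∣ (z + r) - (2 ^ e + 2 ^ t) := by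
    refine parity_rigidity (D := fun u => (c (u - r) : ℕ) % 2) (s := t + 1) (by omega)
      (fun k hk u hu => ?_) fun d hd hd' => ?_
    · have := hr (u - r)
      rw [sub_add_cancel] at this
      exact (this k hk hu).1
    · have := hz d hd (by exact_mod_cast hd')
      rw [show 2 ^ e + 2 ^ t + d - r = 2 ^ e + 2 ^ t - r + d by ring,
        show z + r + d - r = z + d by ring, this]
  have hlev : (z + r) % 2 ^ (e + 1) = 2 ^ e := by
    rw [Int.emod_eq_emod_iff_emod_sub_eq_zero.2 (Int.emod_eq_zero_of_dvd hdvd),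
      two_pow_add_two_pow_emod (by omega) (by omega)]
  have hfar : (z + r) % 2 ^ T ≠ 2 ^ e := by
    intro h
    have h1 : (2 : ℤ) ^ T ∣ z + r - 2 ^ e := by
      rw [← h]; exact Int.dvd_self_sub_emod
    have hmT : (m : ℤ) < 2 ^ (T - 1) := by
      have := Nat.lt_two_pow_self (n := m)
      have h2 : 2 ^ m ≤ 2 ^ (T - 1) := Nat.pow_le_pow_right (by norm_num) (by omega)
      exact_mod_cast this.trans_le h2
    have h2 : (2 : ℤ) ^ T = 2 ^ (T - 1) * 2 := by rw [← pow_succ]; congr 1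
    have h3 := Int.le_of_dvd (by linarith) h1
    linarith
  obtain ⟨t', ht', het', hzt⟩ := exists_emod_two_pow_eq_add hlev (by omega) hfar
  -- The two positions carry the same letter, so their halting bits, for times `t` and `t' < T`,
  -- agree.
  have h1 := ((hr (2 ^ e + 2 ^ t - r)) e (by omega) (by
    rw [sub_add_cancel, two_pow_add_two_pow_emod (by omega) (by omega)])).2 t (by omega) (by omega)
    (by rw [sub_add_cancel, two_pow_add_two_pow_emod_self (by omega)])
  have h2 := (hr z e (by omega) hlev).2 t' (by omega) het' hzt
  have h3 := hz 0 le_rfl (by positivity)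
  rw [add_zero, add_zero] at h3
  rw [h3] at h2
  exact hnot ((h2.1 (h1.2 ht)).mono ht'.le)

theorem not_computable_of_qpFunction_le {c : ℤ → Fin 4}
    (hc : c ∈ SymbolicDynamics.FullShift.forbidden refutedPatterns) (hqp : IsQuasiPeriodic c)
    {q : ℕ → ℕ} (hle : ∀ n, qpFunction c n ≤ q n) : ¬ Computable q := by
  intro hq
  have hbound : ∀ e t, HaltsWithin e t → HaltsWithin e (q (2 ^ (e + 2)) + e + 2) := by
    intro e t ht
    have hmem : IsQPBound c (2 ^ (e + 2)) (qpFunction c (2 ^ (e + 2))) :=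
      -- Quasi-periodicity is used here: the infimum is over a non-empty set, hence attained.
      Nat.sInf_mem (exists_isQPBound hqp _)
    refine (haltsWithin_of_isQPBound hc hmem ht).mono ?_
    have := hle (2 ^ (e + 2))
    omega
  have hadd : Primrec fun e : ℕ => e + 2 := Primrec.nat_add.comp Primrec.id (Primrec.const 2)
  have hg : Computable fun p : Code => q (2 ^ (Encodable.encode p + 2)) + (Encodable.encode p + 2) :=
    (Primrec.nat_add.to_comp).comp
      (hq.comp ((primrec_two_pow.comp (hadd.comp Primrec.encode)).to_comp))
      (hadd.comp Primrec.encode).to_comp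
  obtain ⟨_, hdec⟩ := primrecRel_haltsWithin
  refine ComputablePred.halting_problem 0 (ComputablePred.of_eq (p := fun p : Code =>
    HaltsWithin (Encodable.encode p) (q (2 ^ (Encodable.encode p + 2)) + (Encodable.encode p + 2)))
    ?_ fun p => ?_)
  · classical
    refine Computable.computablePred ?_
    exact ((hdec.to_comp.comp (Computable.encode.pair hg))).of_eq fun p => by simp
  · rw [dom_eval_iff_exists_haltsWithin]
    exact ⟨fun h => ⟨_, h⟩, fun ⟨t, ht⟩ => hbound _ t ht⟩

end QPSubshift

theorem mainTheorem3 :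
    ∃ (k : ℕ) (X : SymbolicDynamics.FullShift.Subshift (Fin (k + 1)) ℤ),
      QPSubshift.IsEffective X ∧ X.carrier.Nonempty ∧
        ∀ c ∈ X.carrier, QPSubshift.IsQuasiPeriodic c →
          ¬ ∃ q : ℕ → ℕ, Computable q ∧ ∀ n : ℕ, QPSubshift.qpFunction c n ≤ q n := by
  refine ⟨3, SymbolicDynamics.FullShift.Subshift.ofForbidden QPSubshift.refutedPatterns,
    ⟨_, ⟨_, QPSubshift.rePred_exists_isRefuted, rfl⟩, rfl⟩,
    QPSubshift.nonempty_forbidden_refutedPatterns, ?_⟩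
  rintro c hc hqp ⟨q, hq, hle⟩
  exact QPSubshift.not_computable_of_qpFunction_le hc hqp hle hq
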